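/- Write $(a;q)_n=\prod_{i=0}^{n-1}(1-aq^i)$, $(a;q)_\infty=\prod_{i\ge 0}(1-aq^i)$, $(a_1,\dots,a_m;q)_\infty=\prod_{i=1}^m(a_i;q)_\infty$, and let $\genfrac{[}{]}{0pt}{}{L}{a}_q=\frac{(q;q)_L}{(q;q)_a(q;q)_{L-a}}$ if $0\le a\le L$ and $0$ otherwise. Let $k\ge 2$ be an integer and let $q$ be a complex number with $|q|<1$. Then, with the convention $n_k:=0$, $$ \sum_{n_1,\dots,n_{k-1}\ge 0} \frac{q^{n_1^2+2n_2^2+\cdots+2^{k-2}n_{k-1}^2}}{(q;q)_{2n_1}} \prod_{j=2}^{k}\left(-q^{2^{j-2}};q^{2^{j-2}}\right)_{n_{j-1}-2n_j} \genfrac{[}{]}{0pt}{}{n_{j-1}}{2n_j}_{q^{2^{j-1}}} =\frac{\left(q^{\frac12(4^k-2^k)},\,q^{\frac12 4^k},\,q^{4^k-2^{k-1}};\,q^{4^k-2^{k-1}}\right)_\infty}{(q;q)_\infty}, $$ where the sum converges absolutely (terms with $n_{j-1}<2n_j$ for some $2\le j\le k$ are zero, because the corresponding $q$-binomial coefficient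 is zero). -/

import Mathlib

/-- The finite `q`-shifted factorial `(a; q)_n = ∏_{0 ≤ i < n} (1 - a q^i)`. -/
noncomputable def qPoch (a q : ℂ) (n : ℕ) : ℂ :=
  ∏ i ∈ Finset.range n, (1 - a * q ^ i)

/-- The infinite `q`-shifted factorial `(a; q)_∞ = ∏_{i ≥ 0} (1 - a q^i)`. -/
noncomputable def qPochInf (a q : ℂ) : ℂ :=
  ∏' i : ℕ, (1 - a * q ^ i)

/-- For `|q| < 1` the product defining `(a; q)_∞` converges, so the value of `qPochInf` is the
genuine one. -/
theorem multipliable_qPochInf (a q : ℂ) (hq : ‖q‖ < 1) :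
    Multipliable (fun i : ℕ => 1 - a * q ^ i) := by
  have h : Summable (fun i : ℕ => ‖-(a * q ^ i)‖) := by
    have h0 := (summable_geometric_of_lt_one (norm_nonneg q) hq).mul_left ‖a‖
    simpa [norm_mul, norm_pow] using h0
  simpa [sub_eq_add_neg] using multipliable_one_add_of_summable h

/-- The `q`-binomial coefficient `[L; a]_q`, equal to `(q; q)_L / ((q; q)_a (q; q)_{L-a})` for
`0 ≤ a ≤ L` and to `0` otherwise. -/
noncomputable def qBinom (q : ℂ) (L a : ℕ) : ℂ :=
  if a ≤ L then qPoch q q L / (qPoch q q a * qPoch q q (L - a)) else 0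

/-- For a tuple `n = (n_1, …, n_{k-1})`, stored as a function on `Fin (k - 1)`, `rrIndex n j` is
`n_j` for `1 ≤ j ≤ k - 1`. It is `0` at other `j`; this includes the convention `n_k = 0`, while the
value at `j = 0` is never used. -/
def rrIndex {k : ℕ} (n : Fin (k - 1) → ℕ) (j : ℕ) : ℕ :=
  if h : 1 ≤ j ∧ j ≤ k - 1 then n ⟨j - 1, by omega⟩ else 0

/-- The summand of the multisum, for the tuple `n = (n_1, …, n_{k-1})`. When `n_{j-1} < 2 n_j` the
factor with index `j` vanishes because the `q`-binomial coefficient is zero, whatever value is given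
to the `q`-shifted factorial of negative index (here the subtraction is truncated). -/
noncomputable def rrTerm (k : ℕ) (q : ℂ) (n : Fin (k - 1) → ℕ) : ℂ :=
  q ^ (∑ j ∈ Finset.Icc 1 (k - 1), 2 ^ (j - 1) * rrIndex n j ^ 2)
    / qPoch q q (2 * rrIndex n 1)
    * ∏ j ∈ Finset.Icc 2 k,
        (qPoch (-q ^ 2 ^ (j - 2)) (q ^ 2 ^ (j - 2)) (rrIndex n (j - 1) - 2 * rrIndex n j)
          * qBinom (q ^ 2 ^ (j - 1)) (rrIndex n (j - 1)) (2 * rrIndex n j))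

/-! The engine is a change of base. Summing the kernel `baseStep q N r` against central q-binomials
`[2r; r+s]` in base `q²` gives `q^{2s²} [2N; N+2s]` in base `q` (`sum_baseStep_mul_qBinom`, a form
of q-Chu–Vandermonde). The seed is the finite Jacobi triple product at `x = 1`: its theta sum is 1
at `N = 0` and 0 otherwise (`thetaSum_zero`). Applying the kernel in bases `…, q⁴, q², q` to this
delta turns it into a multisum over chains equal to an explicit theta sum (`hasSum_stepChain`).

Now take `p² = q`, run `k` kernels starting from base `p`, and let `N → ∞`. The outermost kernel
tends to `(-p;p)_∞ q^{n₁²}/(q;q)_{2n₁}`, so the multisum becomes `(-p;p)_∞` times the required one,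
while the theta sum becomes a full theta series over `(p;p)_∞`. Since `(-p;p)_∞ (p;p)_∞ = (q;q)_∞`,
the Jacobi triple product (`tsum_thetaTerm`) finishes. Bounds uniform in `N`
(`exists_norm_stepChain_le`) justify the limit. -/

/-! ### Finite q-factorials and q-Pascal rules. -/

theorem qPoch_zero (a q : ℂ) : qPoch a q 0 = 1 := by simp [qPoch]

theorem qPoch_succ (a q : ℂ) (n : ℕ) : qPoch a q (n + 1) = qPoch a q n * (1 - a * q ^ n) := by
  simp [qPoch, Finset.prod_range_succ]

theorem qPoch_self_succ (q : ℂ) (n : ℕ) :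
    qPoch q q (n + 1) = qPoch q q n * (1 - q ^ (n + 1)) := by
  rw [qPoch_succ, pow_succ']

theorem one_sub_pow_succ_ne_zero {q : ℂ} (hq : ‖q‖ < 1) (n : ℕ) : 1 - q ^ (n + 1) ≠ 0 := by
  intro h
  have h1 : ‖q ^ (n + 1)‖ < 1 := by
    rw [norm_pow]
    exact pow_lt_one₀ (norm_nonneg q) hq n.succ_ne_zero
  rw [← sub_eq_zero.mp h, norm_one] at h1
  exact lt_irrefl _ h1

theorem qPoch_self_ne_zero {q : ℂ} (hq : ‖q‖ < 1) (n : ℕ) : qPoch q q n ≠ 0 := by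
  induction n with
  | zero => simp [qPoch_zero]
  | succ n ih =>
    rw [qPoch_self_succ]
    exact mul_ne_zero ih (one_sub_pow_succ_ne_zero hq n)

theorem norm_sq_lt_one {q : ℂ} (hq : ‖q‖ < 1) : ‖q ^ 2‖ < 1 := by
  rw [norm_pow]
  exact pow_lt_one₀ (norm_nonneg q) hq two_ne_zero

theorem qPoch_neg_mul_qPoch (q : ℂ) (n : ℕ) :
    qPoch (-q) q n * qPoch q q n = qPoch (q ^ 2) (q ^ 2) n := by
  simp only [qPoch, ← Finset.prod_mul_distrib]
  refine Finset.prod_congr rfl fun i _ => ?_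
  ring

theorem qPoch_two_mul (q : ℂ) (n : ℕ) :
    qPoch q q (2 * n) = qPoch q (q ^ 2) n * qPoch (q ^ 2) (q ^ 2) n := by
  induction n with
  | zero => simp [qPoch_zero]
  | succ n ih =>
    rw [show 2 * (n + 1) = 2 * n + 1 + 1 by ring, qPoch_self_succ, qPoch_self_succ, ih, qPoch_succ,
      qPoch_self_succ]
    ring

theorem qBinom_of_le {q : ℂ} {L a : ℕ} (h : a ≤ L) :
    qBinom q L a = qPoch q q L / (qPoch q q a * qPoch q q (L - a)) := if_pos h

theorem qBinom_of_lt {q : ℂ} {L a : ℕ} (h : L < a) : qBinom q L a = 0 := if_neg (by omega)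

theorem qBinom_zero_right {q : ℂ} (hq : ‖q‖ < 1) (L : ℕ) : qBinom q L 0 = 1 := by
  rw [qBinom_of_le (Nat.zero_le _), qPoch_zero, one_mul, Nat.sub_zero,
    div_self (qPoch_self_ne_zero hq L)]

theorem qBinom_self {q : ℂ} (hq : ‖q‖ < 1) (L : ℕ) : qBinom q L L = 1 := by
  rw [qBinom_of_le le_rfl, Nat.sub_self, qPoch_zero, mul_one, div_self (qPoch_self_ne_zero hq L)]

theorem qBinom_symm {q : ℂ} {L a b : ℕ} (h : a + b = L) : qBinom q L a = qBinom q L b := by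
  rw [qBinom_of_le (by omega), qBinom_of_le (by omega), show L - a = b by omega,
    show L - b = a by omega, mul_comm]

/-- First `q`-Pascal rule. -/
theorem qBinom_succ_succ {q : ℂ} (hq : ‖q‖ < 1) {L a : ℕ} (h : a ≤ L) :
    qBinom q (L + 1) (a + 1) = qBinom q L (a + 1) + q ^ (L - a) * qBinom q L a := by
  obtain ⟨c, rfl⟩ := Nat.exists_eq_add_of_le h
  rcases c with _ | c
  · simp [qBinom_self hq, qBinom_of_lt (show a < a + 1 by omega)]
  · rw [qBinom_of_le (by omega), qBinom_of_le (by omega), qBinom_of_le (by omega),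
      show a + (c + 1) + 1 - (a + 1) = c + 1 by omega, show a + (c + 1) - (a + 1) = c by omega,
      show a + (c + 1) - a = c + 1 by omega, qPoch_self_succ q (a + (c + 1)), qPoch_self_succ q a,
      qPoch_self_succ q c]
    have h1 := qPoch_self_ne_zero hq a
    have h2 := qPoch_self_ne_zero hq c
    have h3 := one_sub_pow_succ_ne_zero hq a
    have h4 := one_sub_pow_succ_ne_zero hq c
    field_simp
    ring

/-- Second `q`-Pascal rule. -/
theorem qBinom_succ_succ' {q : ℂ} (hq : ‖q‖ < 1) {L a : ℕ} (h : a ≤ L) :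
    qBinom q (L + 1) (a + 1) = q ^ (a + 1) * qBinom q L (a + 1) + qBinom q L a := by
  obtain ⟨c, rfl⟩ := Nat.exists_eq_add_of_le h
  rcases c with _ | c
  · simp [qBinom_self hq, qBinom_of_lt (show a < a + 1 by omega)]
  · rw [qBinom_of_le (by omega), qBinom_of_le (by omega), qBinom_of_le (by omega),
      show a + (c + 1) + 1 - (a + 1) = c + 1 by omega, show a + (c + 1) - (a + 1) = c by omega,
      show a + (c + 1) - a = c + 1 by omega, qPoch_self_succ q (a + (c + 1)), qPoch_self_succ q a,
      qPoch_self_succ q c]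
    have h1 := qPoch_self_ne_zero hq a
    have h2 := qPoch_self_ne_zero hq c
    have h3 := one_sub_pow_succ_ne_zero hq a
    have h4 := one_sub_pow_succ_ne_zero hq c
    field_simp
    ring

/-! ### A quadratic q-Chu–Vandermonde sum. -/

/-- The summand of the quadratic `q`-Chu–Vandermonde sum `sum_vandermondeTerm`. -/
noncomputable def vandermondeTerm (q : ℂ) (t M i : ℕ) : ℂ :=
  if 2 * i ≤ M then
    q ^ (2 * i ^ 2 + 2 * i * t)
      / (qPoch q q (M - 2 * i) * qPoch (q ^ 2) (q ^ 2) i * qPoch (q ^ 2) (q ^ 2) (i + t))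
  else 0

/-- The Wilf–Zeilberger certificate for `sum_vandermondeTerm`. -/
noncomputable def vandermondeCert (q : ℂ) (t M i : ℕ) : ℂ :=
  -(q ^ (M - 2 * i) * (1 - q ^ (2 * i)) * (1 - q ^ (2 * (i + t)))) * vandermondeTerm q t M i

theorem vandermondeTerm_telescope {q : ℂ} (hq : ‖q‖ < 1) (t M i : ℕ) :
    (1 - q ^ (M + 1)) * (1 - q ^ (M + 1 + 2 * t)) * vandermondeTerm q t (M + 1) i
      - (1 - q ^ (2 * (M + t) + 1)) * vandermondeTerm q t M i
      = vandermondeCert q t (M + 1) (i + 1) - vandermondeCert q t (M + 1) i := by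
  have hq2 := norm_sq_lt_one hq
  have h1 := qPoch_self_ne_zero hq2 i
  have h2 := qPoch_self_ne_zero hq2 (i + t)
  unfold vandermondeCert
  rcases lt_or_ge (M + 1) (2 * i) with h | h
  · simp [vandermondeTerm, show ¬ 2 * i ≤ M + 1 by omega, show ¬ 2 * i ≤ M by omega,
      show ¬ 2 * (i + 1) ≤ M + 1 by omega]
  obtain ⟨c, hc⟩ := Nat.exists_eq_add_of_le h
  -- The gap `c = M + 1 - 2i` decides which terms survive: for 0 only `(M+1, i)`, for 1 also `(M,
  -- i)`, and from 2 on also `(M+1, i+1)`.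
  rcases c with _ | _ | c
  · have e : M + 1 = 2 * i := by omega
    rw [show vandermondeTerm q t M i = 0 from if_neg (by omega),
      show vandermondeTerm q t (M + 1) (i + 1) = 0 from if_neg (by omega), e, Nat.sub_self]
    ring
  · have e : M = 2 * i := by omega
    subst e
    rw [show vandermondeTerm q t (2 * i + 1) (i + 1) = 0 from if_neg (by omega),
      vandermondeTerm, vandermondeTerm, if_pos (by omega), if_pos (by omega),
      show 2 * i + 1 - 2 * i = 0 + 1 by omega, Nat.sub_self, qPoch_self_succ, qPoch_zero]
    have h3 := one_sub_pow_succ_ne_zero hq 0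
    field_simp
    ring
  · have e : M = 2 * i + c + 1 := by omega
    subst e
    rw [vandermondeTerm, vandermondeTerm, vandermondeTerm, if_pos (by omega), if_pos (by omega),
      if_pos (by omega), show 2 * i + c + 1 + 1 - 2 * i = c + 1 + 1 by omega,
      show 2 * i + c + 1 - 2 * i = c + 1 by omega,
      show 2 * i + c + 1 + 1 - 2 * (i + 1) = c by omega, show i + 1 + t = i + t + 1 by omega,
      qPoch_self_succ q (c + 1), qPoch_self_succ q c, qPoch_self_succ (q ^ 2) i,
      qPoch_self_succ (q ^ 2) (i + t)]
    have h3 := one_sub_pow_succ_ne_zero hq c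
    have h4 := one_sub_pow_succ_ne_zero hq (c + 1)
    have h5 := one_sub_pow_succ_ne_zero hq2 i
    have h6 := one_sub_pow_succ_ne_zero hq2 (i + t)
    have h7 := qPoch_self_ne_zero hq c
    field_simp
    ring

/-- A quadratic form of the terminating `q`-Chu–Vandermonde sum. -/
theorem sum_vandermondeTerm {q : ℂ} (hq : ‖q‖ < 1) (t M : ℕ) :
    ∑ i ∈ Finset.range (M + 1), vandermondeTerm q t M i
      = qPoch q (q ^ 2) (M + t) / (qPoch q q M * qPoch q q (M + 2 * t)) := by
  have hq2 := norm_sq_lt_one hq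
  induction M with
  | zero =>
    have h1 := qPoch_self_ne_zero hq2 t
    have h2 := qPoch_self_ne_zero hq (2 * t)
    rw [qPoch_two_mul] at h2
    simp only [zero_add, Finset.range_one, Finset.sum_singleton, vandermondeTerm, qPoch_two_mul,
      qPoch_zero]
    have h3 := left_ne_zero_of_mul h2
    simp [qPoch_zero]
    field_simp
  | succ M ih =>
    have h1 := one_sub_pow_succ_ne_zero hq M
    have h2 := one_sub_pow_succ_ne_zero hq (M + 2 * t)
    have h3 := qPoch_self_ne_zero hq M
    have h4 := qPoch_self_ne_zero hq (M + 2 * t)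
    -- The certificate vanishes at both ends, so telescoping leaves a first-order recurrence in `M`,
    -- which the closed form also satisfies.
    have tel := Finset.sum_range_sub (vandermondeCert q t (M + 1)) (M + 2)
    rw [← Finset.sum_congr rfl fun i _ => vandermondeTerm_telescope hq t M i,
      Finset.sum_sub_distrib, ← Finset.mul_sum, ← Finset.mul_sum,
      Finset.sum_range_succ (vandermondeTerm q t M), ih,
      show vandermondeTerm q t M (M + 1) = 0 from if_neg (by omega),
      show vandermondeCert q t (M + 1) (M + 2) = 0 by
        simp [vandermondeCert, vandermondeTerm, show ¬ 2 * (M + 2) ≤ M + 1 by omega],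
      show vandermondeCert q t (M + 1) 0 = 0 by simp [vandermondeCert]] at tel
    rw [show M + 1 + t = M + t + 1 by ring, show M + 1 + 2 * t = M + 2 * t + 1 by ring,
      qPoch_succ, qPoch_self_succ, qPoch_self_succ]
    rw [show M + 1 + 2 * t = M + 2 * t + 1 by ring] at tel
    rw [eq_div_iff (by positivity)]
    field_simp at tel
    linear_combination tel

/-! ### The change of base. -/

/-- The change-of-base kernel `q^{2r²} (-q;q)_{N-2r} [N; 2r]_{q²}`. -/
noncomputable def baseStep (q : ℂ) (N r : ℕ) : ℂ :=
  q ^ (2 * r ^ 2) * (qPoch (-q) q (N - 2 * r) * qBinom (q ^ 2) N (2 * r))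

theorem baseStep_of_lt {q : ℂ} {N r : ℕ} (h : N < 2 * r) : baseStep q N r = 0 := by
  simp [baseStep, qBinom_of_lt h]

/-- Writing `(-q;q)_n` as `(q²;q²)_n / (q;q)_n` cancels both `(q²;q²)_{N-2r}` and `(q²;q²)_{2r}`;
what is left is a Vandermonde summand with `t = 2s`, `r = s + i`. -/
theorem baseStep_mul_qBinom {q : ℂ} (hq : ‖q‖ < 1) (M s i : ℕ) :
    baseStep q (M + 2 * s) (s + i) * qBinom (q ^ 2) (2 * (s + i)) (s + i + s)
      = q ^ (2 * s ^ 2) * qPoch (q ^ 2) (q ^ 2) (M + 2 * s) * vandermondeTerm q (2 * s) M i := by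
  have hq2 := norm_sq_lt_one hq
  by_cases h : 2 * i ≤ M
  · rw [baseStep, qBinom_of_le (by omega), qBinom_of_le (by omega), vandermondeTerm, if_pos h,
      show M + 2 * s - 2 * (s + i) = M - 2 * i by omega, show s + i + s = i + 2 * s by ring,
      show 2 * (s + i) - (i + 2 * s) = i by omega, ← qPoch_neg_mul_qPoch q (M - 2 * i)]
    have h1 := qPoch_self_ne_zero hq2 i
    have h2 := qPoch_self_ne_zero hq2 (i + 2 * s)
    have h3 := qPoch_self_ne_zero hq (M - 2 * i)
    have h4 := qPoch_self_ne_zero hq2 (2 * (s + i))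
    have h5 := qPoch_self_ne_zero hq2 (M - 2 * i)
    rw [← qPoch_neg_mul_qPoch] at h5
    have h6 := left_ne_zero_of_mul h5
    field_simp
    ring
  · rw [baseStep_of_lt (by omega), vandermondeTerm, if_neg h]
    ring

/-- The change-of-base transformation of central `q`-binomial coefficients. -/
theorem sum_baseStep_mul_qBinom {q : ℂ} (hq : ‖q‖ < 1) (N s : ℕ) :
    ∑ r ∈ Finset.range (N + 1), baseStep q N r * qBinom (q ^ 2) (2 * r) (r + s)
      = q ^ (2 * s ^ 2) * qBinom q (2 * N) (N + 2 * s) := by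
  rcases lt_or_ge N (2 * s) with h | h
  · rw [qBinom_of_lt (by omega), mul_zero]
    refine Finset.sum_eq_zero fun r _ => ?_
    rcases lt_or_ge r s with h' | h'
    · rw [qBinom_of_lt (by omega), mul_zero]
    · rw [baseStep_of_lt (by omega), zero_mul]
  obtain ⟨M, rfl⟩ := Nat.exists_eq_add_of_le' h
  rw [show M + 2 * s + 1 = s + (M + 1 + s) by ring, Finset.sum_range_add,
    Finset.sum_range_add _ (M + 1) s, Finset.sum_eq_zero (s := Finset.range s), zero_add,
    Finset.sum_eq_zero (s := Finset.range s), add_zero,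
    Finset.sum_congr rfl fun i _ => baseStep_mul_qBinom hq M s i, ← Finset.mul_sum,
    sum_vandermondeTerm hq, qBinom_of_le (by omega), qPoch_two_mul,
    show 2 * (M + 2 * s) - (M + 2 * s + 2 * s) = M by omega,
    show M + 2 * s + 2 * s = M + 2 * (2 * s) by ring]
  · ring
  · intro r hr
    rw [baseStep_of_lt (by omega), zero_mul]
  · intro r hr
    rw [qBinom_of_lt (by have := Finset.mem_range.mp hr; omega), mul_zero]

/-! ### The finite Jacobi triple product. -/

/-- The triangular number `j (j - 1) / 2` of an integer `j`. -/
def triangular (j : ℤ) : ℕ := (j * (j - 1) / 2).toNat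

theorem two_mul_triangular (j : ℤ) : 2 * (triangular j : ℤ) = j * (j - 1) := by
  have h0 : 0 ≤ j * (j - 1) := by
    rcases lt_or_ge j 1 with h | h
    · nlinarith
    · exact mul_nonneg (by omega) (by omega)
  have h1 : (2 : ℤ) ∣ j * (j - 1) := by
    have := (Int.even_mul_pred_self j).two_dvd
    exact this
  rw [triangular, Int.toNat_of_nonneg (by omega)]
  omega

/-- The general term `(-1)^j x^{j(j+1)/2} y^{j(j-1)/2}` of the two-variable theta series. -/
noncomputable def thetaTerm (x y : ℂ) (j : ℤ) : ℂ :=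
  (-1) ^ j * (x ^ triangular (-j) * y ^ triangular j)

theorem mul_thetaTerm (x y : ℂ) {j : ℤ} {m c : ℕ} (h : j + c = m) :
    x * (x * y) ^ m * thetaTerm x y j = -thetaTerm x y (j + 1) * (x * y) ^ c := by
  have h1 : triangular (-j) + m + 1 = triangular (-(j + 1)) + c := by
    have e1 := two_mul_triangular (-j)
    have e2 := two_mul_triangular (-(j + 1))
    zify
    linarith
  have h2 : triangular j + m = triangular (j + 1) + c := by
    have e1 := two_mul_triangular j
    have e2 := two_mul_triangular (j + 1)
    zify
    linarith
  rw [thetaTerm, thetaTerm, zpow_add_one₀ (by norm_num), mul_pow, mul_pow]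
  calc _ = (-1) ^ j * (x ^ (triangular (-j) + m + 1) * y ^ (triangular j + m)) := by ring
    _ = _ := by rw [h1, h2]; ring

theorem mul_thetaTerm_succ (x y : ℂ) {j : ℤ} {n c : ℕ} (h : n + 1 + j = c) :
    y * (x * y) ^ n * thetaTerm x y (j + 1) = -thetaTerm x y j * (x * y) ^ c := by
  have h1 : triangular (-(j + 1)) + n = triangular (-j) + c := by
    have e1 := two_mul_triangular (-j)
    have e2 := two_mul_triangular (-(j + 1))
    zify
    linarith
  have h2 : triangular (j + 1) + n + 1 = triangular j + c := by
    have e1 := two_mul_triangular j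
    have e2 := two_mul_triangular (j + 1)
    zify
    linarith
  rw [thetaTerm, thetaTerm, zpow_add_one₀ (by norm_num), mul_pow, mul_pow]
  calc _ = -(-1) ^ j * (x ^ (triangular (-(j + 1)) + n) * y ^ (triangular (j + 1) + n + 1)) := by
        ring
    _ = _ := by rw [h1, h2]; ring

/-- Multiplying by one linear factor raises the top index by one: the relation on `A` turns the
product by `c` into the shifted term of the first Pascal rule. -/
theorem one_sub_mul_sum_qBinom {q : ℂ} (hq : ‖q‖ < 1) {N : ℕ} {A : ℕ → ℂ} {c : ℂ}
    (h : ∀ i ≤ N, c * A i = -A (i + 1) * q ^ (N - i)) :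
    (1 - c) * ∑ i ∈ Finset.range (N + 1), A i * qBinom q N i
      = ∑ i ∈ Finset.range (N + 2), A i * qBinom q (N + 1) i := by
  have e1 : ∑ i ∈ Finset.range (N + 1), A i * qBinom q N i
      = ∑ i ∈ Finset.range (N + 1), A (i + 1) * qBinom q N (i + 1) + A 0 := by
    have := Finset.sum_range_succ' (fun i => A i * qBinom q N i) (N + 1)
    rw [Finset.sum_range_succ, qBinom_of_lt (Nat.lt_succ_self N), qBinom_zero_right hq] at this
    simpa using this
  rw [Finset.sum_range_succ' _ (N + 1), qBinom_zero_right hq, sub_mul, one_mul, Finset.mul_sum, e1, mul_one,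
    add_sub_right_comm, ← Finset.sum_sub_distrib]
  congr 1
  refine Finset.sum_congr rfl fun i hi => ?_
  have hi' : i ≤ N := Nat.lt_succ_iff.mp (Finset.mem_range.mp hi)
  rw [qBinom_succ_succ hq hi', ← mul_assoc, h i hi']
  ring

/-- The counterpart for the second Pascal rule. The weights are shifted by one because the factor in
`y` extends the theta range at its lower end. -/
theorem one_sub_mul_sum_qBinom' {q : ℂ} (hq : ‖q‖ < 1) {N : ℕ} {A : ℕ → ℂ} {c : ℂ}
    (h : ∀ i ≤ N, c * A (i + 1) = -A i * q ^ i) :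
    (1 - c) * ∑ i ∈ Finset.range (N + 1), A (i + 1) * qBinom q N i
      = ∑ i ∈ Finset.range (N + 2), A i * qBinom q (N + 1) i := by
  have e1 : ∑ i ∈ Finset.range (N + 1), A i * q ^ i * qBinom q N i
      = ∑ i ∈ Finset.range (N + 1), A (i + 1) * q ^ (i + 1) * qBinom q N (i + 1) + A 0 := by
    have := Finset.sum_range_succ' (fun i => A i * q ^ i * qBinom q N i) (N + 1)
    rw [Finset.sum_range_succ, qBinom_of_lt (Nat.lt_succ_self N), qBinom_zero_right hq] at this
    simpa using this
  have e2 : c * ∑ i ∈ Finset.range (N + 1), A (i + 1) * qBinom q N i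
      = -∑ i ∈ Finset.range (N + 1), A i * q ^ i * qBinom q N i := by
    rw [Finset.mul_sum, ← Finset.sum_neg_distrib]
    refine Finset.sum_congr rfl fun i hi => ?_
    rw [← mul_assoc, h i (Nat.lt_succ_iff.mp (Finset.mem_range.mp hi))]
    ring
  rw [Finset.sum_range_succ' _ (N + 1), qBinom_zero_right hq, sub_mul, one_mul, e2, e1, mul_one,
    sub_neg_eq_add, ← add_assoc, ← Finset.sum_add_distrib]
  congr 1
  refine Finset.sum_congr rfl fun i hi => ?_
  rw [qBinom_succ_succ' hq (Nat.lt_succ_iff.mp (Finset.mem_range.mp hi))]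
  ring

/-- The finite Jacobi triple product, over a range of natural numbers. -/
theorem qPoch_mul_qPoch_eq_sum_range (x y : ℂ) (hq : ‖x * y‖ < 1) (r : ℕ) :
    qPoch x (x * y) r * qPoch y (x * y) r
      = ∑ i ∈ Finset.range (2 * r + 1),
          thetaTerm x y ((i : ℤ) - r) * qBinom (x * y) (2 * r) i := by
  induction r with
  | zero => simp [qPoch_zero, qBinom_zero_right hq, thetaTerm, triangular]
  | succ r ih =>
    have e1 := one_sub_mul_sum_qBinom hq (N := 2 * r) (c := x * (x * y) ^ r)
      (A := fun i => thetaTerm x y ((i : ℤ) - r)) fun i hi => by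
        rw [mul_thetaTerm x y (c := 2 * r - i) (by push_cast [hi]; ring)]
        push_cast
        ring_nf
    have e2 := one_sub_mul_sum_qBinom' hq (N := 2 * r + 1) (c := y * (x * y) ^ r)
      (A := fun i => thetaTerm x y ((i : ℤ) - (r + 1))) fun i hi => by
        rw [← mul_thetaTerm_succ x y (n := r) (by ring)]
        push_cast
        ring_nf
    rw [qPoch_succ, qPoch_succ, show 2 * (r + 1) = 2 * r + 1 + 1 by ring]
    push_cast
    have e3 : (fun i : ℕ => thetaTerm x y ((i : ℤ) - r))
        = fun i : ℕ => thetaTerm x y (((i + 1 : ℕ) : ℤ) - (r + 1)) := by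
      funext i
      push_cast
      ring_nf
    simp only [← ih] at e1
    rw [← e2]
    simp only [← congrFun e3]
    rw [← e1]
    ring

/-- The symmetry `[2r; r+j] = [2r; r-j]` permits `|j|` as lower index. The cut-off `B` is free since
terms with `|j| > r` vanish, so one index set can serve all `r ≤ B`. -/
theorem sum_range_eq_sum_Icc {q : ℂ} (f : ℤ → ℂ) {r B : ℕ} (h : r ≤ B) :
    ∑ i ∈ Finset.range (2 * r + 1), f ((i : ℤ) - r) * qBinom q (2 * r) i
      = ∑ j ∈ Finset.Icc (-B : ℤ) B, f j * qBinom q (2 * r) (r + j.natAbs) := by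
  rw [← Finset.sum_subset (s₁ := Finset.Icc (-r : ℤ) r)
    (Finset.Icc_subset_Icc (by omega) (by omega))]
  · refine Finset.sum_bij' (fun i _ => (i : ℤ) - r) (fun j _ => (j + r).toNat) ?_ ?_ ?_ ?_ ?_
    · intro i hi
      simp only [Finset.mem_range, Finset.mem_Icc] at *
      omega
    · intro i hi
      simp only [Finset.mem_range, Finset.mem_Icc] at *
      omega
    · intro i hi
      simp
    · intro j hj
      simp only [Finset.mem_Icc] at *
      omega
    · intro i hi
      simp only [Finset.mem_range] at hi
      rcases le_total r i with h' | h'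
      · rw [show r + ((i : ℤ) - r).natAbs = i by omega]
      · rw [qBinom_symm (a := i) (b := r + ((i : ℤ) - r).natAbs) (by omega)]
  · intro j _ hj
    rw [qBinom_of_lt, mul_zero]
    simp only [Finset.mem_Icc] at hj
    omega

/-- The finite Jacobi triple product. -/
theorem qPoch_mul_qPoch_eq_sum_Icc {x y q : ℂ} (hxy : x * y = q) (hq : ‖q‖ < 1) {r B : ℕ}
    (h : r ≤ B) :
    qPoch x q r * qPoch y q r
      = ∑ j ∈ Finset.Icc (-B : ℤ) B, thetaTerm x y j * qBinom q (2 * r) (r + j.natAbs) := by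
  subst hxy
  rw [qPoch_mul_qPoch_eq_sum_range x y hq, sum_range_eq_sum_Icc _ h]

/-! ### Iterating the change of base on theta sums. -/

/-- The partial theta sums `∑_{|j| ≤ B} (-1)^j q^{e_m(j)} [2N; N - 2^m j]` with
`e_m(j) = 2^(m-1) ((2^(m+1) - 1) j² - j)`. -/
noncomputable def thetaSum (m : ℕ) (q : ℂ) (N B : ℕ) : ℂ :=
  ∑ j ∈ Finset.Icc (-B : ℤ) B,
    (-1) ^ j * q ^ (2 ^ m * (triangular j + (2 ^ m - 1) * j.natAbs ^ 2))
      * qBinom q (2 * N) (N + 2 ^ m * j.natAbs)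

/-- The theta sum factors as `(1;q)_N (q;q)_N`, and `(1;q)_N` contains the factor 0 as soon as `N >
0`. -/
theorem thetaSum_zero {q : ℂ} (hq : ‖q‖ < 1) {N B : ℕ} (h : N ≤ B) :
    thetaSum 0 q N B = if N = 0 then 1 else 0 := by
  have := qPoch_mul_qPoch_eq_sum_Icc (x := 1) (one_mul q) hq h
  have e : thetaSum 0 q N B = qPoch 1 q N * qPoch q q N := by
    rw [this]
    simp [thetaSum, thetaTerm]
  rw [e]
  split_ifs with h0
  · simp [h0, qPoch_zero]
  · obtain ⟨n, rfl⟩ := Nat.exists_eq_succ_of_ne_zero h0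
    simp [qPoch, Finset.prod_range_succ']

theorem sum_baseStep_mul_thetaSum {q : ℂ} (hq : ‖q‖ < 1) (m N B : ℕ) :
    ∑ r ∈ Finset.range (N + 1), baseStep q N r * thetaSum m (q ^ 2) r B
      = thetaSum (m + 1) q N B := by
  simp only [thetaSum, Finset.mul_sum]
  rw [Finset.sum_comm]
  refine Finset.sum_congr rfl fun j _ => ?_
  have key := sum_baseStep_mul_qBinom hq N (2 ^ m * j.natAbs)
  -- Passing from base `q²` to `q` doubles the exponent; the change of base with `s = 2^m |j|` adds
  -- `2s²`.
  have e : 2 ^ (m + 1) * (triangular j + (2 ^ (m + 1) - 1) * j.natAbs ^ 2)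
      = 2 * (2 ^ m * (triangular j + (2 ^ m - 1) * j.natAbs ^ 2))
        + 2 * (2 ^ m * j.natAbs) ^ 2 := by
    obtain ⟨u, hu⟩ := Nat.exists_eq_succ_of_ne_zero (pow_ne_zero m (two_ne_zero (α := ℕ)))
    rw [pow_succ, hu, show u.succ * 2 - 1 = 2 * u + 1 by omega, Nat.succ_sub_one]
    simp only [Nat.succ_eq_add_one]
    ring
  rw [e, pow_add, pow_mul q 2, show 2 ^ (m + 1) * j.natAbs = 2 * (2 ^ m * j.natAbs) by ring]
  calc _ = (-1) ^ j * (q ^ 2) ^ (2 ^ m * (triangular j + (2 ^ m - 1) * j.natAbs ^ 2))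
        * ∑ r ∈ Finset.range (N + 1),
          baseStep q N r * qBinom (q ^ 2) (2 * r) (r + 2 ^ m * j.natAbs) := by
        rw [Finset.mul_sum]
        refine Finset.sum_congr rfl fun r _ => ?_
        ring
    _ = _ := by rw [key]; ring

/-! ### Chains of kernels: uniform bounds and summation. -/

/-- The product of the kernels `baseStep` in bases `q, q², q⁴, …` along the sequence
`N, n 0, …, n (d - 1), 0`. -/
noncomputable def stepChain : (d : ℕ) → ℂ → ℕ → (Fin d → ℕ) → ℂ
  | 0, q, N, _ => baseStep q N 0
  | d + 1, q, N, n => baseStep q N (n 0) * stepChain d (q ^ 2) (n 0) (Fin.tail n)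

theorem tendsto_qPoch (a : ℂ) {q : ℂ} (hq : ‖q‖ < 1) :
    Filter.Tendsto (qPoch a q) Filter.atTop (nhds (qPochInf a q)) :=
  (multipliable_qPochInf a q hq).tendsto_prod_tprod_nat

theorem qPochInf_self_ne_zero {q : ℂ} (hq : ‖q‖ < 1) : qPochInf q q ≠ 0 := by
  have h : Summable (fun i : ℕ => ‖-(q * q ^ i)‖) := by
    have h0 := (summable_geometric_of_lt_one (norm_nonneg q) hq).mul_left ‖q‖
    simpa [norm_mul, norm_pow] using h0
  have := tprod_one_add_ne_zero_of_summable (f := fun i : ℕ => -(q * q ^ i)) (fun i => by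
    rw [← sub_eq_add_neg, ← pow_succ']
    exact one_sub_pow_succ_ne_zero hq i) h
  simpa [qPochInf, sub_eq_add_neg] using this

theorem exists_norm_le_of_tendsto {u : ℕ → ℂ} {l : ℂ}
    (h : Filter.Tendsto u Filter.atTop (nhds l)) : ∃ C, 0 ≤ C ∧ ∀ n, ‖u n‖ ≤ C := by
  obtain ⟨C, hC⟩ := (Metric.isBounded_range_of_tendsto u h).exists_norm_le
  exact ⟨C, (norm_nonneg _).trans (hC _ ⟨0, rfl⟩), fun n => hC _ ⟨n, rfl⟩⟩

theorem exists_norm_qBinom_le {q : ℂ} (hq : ‖q‖ < 1) :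
    ∃ C, 0 ≤ C ∧ ∀ L a, ‖qBinom q L a‖ ≤ C := by
  obtain ⟨C, hC0, hC⟩ := exists_norm_le_of_tendsto (tendsto_qPoch q hq)
  obtain ⟨D, hD0, hD⟩ := exists_norm_le_of_tendsto
    ((tendsto_qPoch q hq).inv₀ (qPochInf_self_ne_zero hq))
  refine ⟨C * (D * D), by positivity, fun L a => ?_⟩
  rcases lt_or_ge L a with h | h
  · rw [qBinom_of_lt h, norm_zero]
    positivity
  · rw [qBinom_of_le h, div_eq_mul_inv, mul_inv, norm_mul, norm_mul]
    gcongr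
    · exact hC _
    · exact hD _
    · exact hD _

theorem exists_norm_baseStep_le {q : ℂ} (hq : ‖q‖ < 1) :
    ∃ C, 0 ≤ C ∧ ∀ N r, ‖baseStep q N r‖ ≤ C * ‖q‖ ^ r := by
  obtain ⟨C, hC0, hC⟩ := exists_norm_le_of_tendsto (tendsto_qPoch (-q) hq)
  obtain ⟨D, hD0, hD⟩ := exists_norm_qBinom_le (norm_sq_lt_one hq)
  refine ⟨C * D, by positivity, fun N r => ?_⟩
  rw [baseStep, norm_mul, norm_mul, norm_pow, mul_comm]
  have h : ‖q‖ ^ (2 * r ^ 2) ≤ ‖q‖ ^ r :=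
    pow_le_pow_of_le_one (norm_nonneg q) hq.le (by nlinarith)
  gcongr
  · exact hC _
  · exact hD _ _

/-- The constant does not depend on `N`, so the bound serves both for summability and as the
dominating function when `N → ∞`. -/
theorem exists_norm_stepChain_le (d : ℕ) {q : ℂ} (hq : ‖q‖ < 1) :
    ∃ C, 0 ≤ C ∧ ∀ N n, ‖stepChain d q N n‖ ≤ C * ∏ i, ‖q‖ ^ n i := by
  induction d generalizing q with
  | zero =>
    obtain ⟨C, hC0, hC⟩ := exists_norm_baseStep_le hq
    exact ⟨C, hC0, fun N n => by simpa [stepChain] using hC N 0⟩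
  | succ d ih =>
    obtain ⟨C, hC0, hC⟩ := exists_norm_baseStep_le hq
    obtain ⟨D, hD0, hD⟩ := ih (norm_sq_lt_one hq)
    refine ⟨C * D, by positivity, fun N n => ?_⟩
    rw [stepChain, norm_mul, Fin.prod_univ_succ]
    calc _ ≤ (C * ‖q‖ ^ n 0) * (D * ∏ i, ‖q ^ 2‖ ^ Fin.tail n i) := by
          gcongr
          · exact hC _ _
          · exact hD _ _
      _ ≤ (C * ‖q‖ ^ n 0) * (D * ∏ i : Fin d, ‖q‖ ^ n i.succ) := by
          gcongr with i
          rw [norm_pow]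
          exact pow_le_pow_left₀ (by positivity)
              (pow_le_of_le_one (norm_nonneg q) hq.le two_ne_zero) _
      _ = _ := by ring

theorem summable_prod_pow (d : ℕ) {x : ℝ} (h0 : 0 ≤ x) (h1 : x < 1) :
    Summable fun n : Fin d → ℕ => ∏ i, x ^ n i := by
  induction d with
  | zero => exact Summable.of_finite
  | succ d ih =>
    rw [← (Fin.consEquiv fun _ => ℕ).summable_iff]
    have := (summable_geometric_of_lt_one h0 h1).mul_of_nonneg ih
      (fun n => pow_nonneg h0 n) (fun n => Finset.prod_nonneg fun i _ => pow_nonneg h0 _)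
    simpa [Function.comp_def, Fin.prod_univ_succ, Fin.consEquiv] using this

theorem summable_stepChain (d : ℕ) {q : ℂ} (hq : ‖q‖ < 1) (N : ℕ) :
    Summable (stepChain d q N) := by
  obtain ⟨C, -, hC⟩ := exists_norm_stepChain_le d hq
  exact Summable.of_norm_bounded ((summable_prod_pow d (norm_nonneg q) hq).mul_left C) (hC N)

/-- Summing over the tail of the chain with `n 0 = r` fixed gives the inductive theta sum in base
`q²`. Only `2r ≤ N` contributes, so the same `B` stays admissible. -/
theorem hasSum_stepChain (d : ℕ) {q : ℂ} (hq : ‖q‖ < 1) {N B : ℕ} (h : N ≤ B) :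
    HasSum (stepChain d q N) (thetaSum (d + 1) q N B) := by
  induction d generalizing q N with
  | zero =>
    convert hasSum_unique (stepChain 0 q N) using 1
    rw [← sum_baseStep_mul_thetaSum hq, stepChain, Finset.sum_eq_single_of_mem 0 (by simp)]
    · rw [thetaSum_zero (norm_sq_lt_one hq) (Nat.zero_le _), if_pos rfl, mul_one]
    · intro r hr h0
      rw [thetaSum_zero (norm_sq_lt_one hq) (by have := Finset.mem_range.mp hr; omega), if_neg h0,
        mul_zero]
  | succ d ih =>
    have hs := (Fin.consEquiv fun _ => ℕ).hasSum_iff.mpr (summable_stepChain (d + 1) hq N).hasSum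
    have hfib : ∀ r : ℕ, HasSum
        (fun n : Fin d → ℕ => stepChain (d + 1) q N (Fin.consEquiv (fun _ => ℕ) (r, n)))
        (baseStep q N r * thetaSum (d + 1) (q ^ 2) r B) := by
      intro r
      simp only [stepChain, Fin.consEquiv, Equiv.coe_fn_mk, Fin.cons_zero, Fin.tail_cons]
      rcases lt_or_ge N (2 * r) with hr | hr
      · simp only [baseStep_of_lt hr, zero_mul]
        exact hasSum_zero
      · exact (ih (norm_sq_lt_one hq) (by omega)).mul_left _
    have h1 := hs.prod_fiberwise hfib
    have h2 : HasSum (fun r => baseStep q N r * thetaSum (d + 1) (q ^ 2) r B)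
        (thetaSum (d + 2) q N B) := by
      rw [← sum_baseStep_mul_thetaSum hq]
      refine hasSum_sum_of_ne_finset_zero fun r hr => ?_
      rw [baseStep_of_lt (by simp only [Finset.mem_range] at hr; omega), zero_mul]
    rw [← h1.unique h2]
    exact (summable_stepChain (d + 1) hq N).hasSum

/-! ### Limits as `N → ∞` and the Jacobi triple product. -/

open Filter Topology

theorem tendsto_qBinom {q : ℂ} (hq : ‖q‖ < 1) (a : ℕ) :
    Tendsto (fun N => qBinom q N a) atTop (𝓝 (qPoch q q a)⁻¹) := by
  have h0 := qPochInf_self_ne_zero hq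
  have h1 := tendsto_qPoch q hq
  have h2 : Tendsto (fun N => qPoch q q N / (qPoch q q a * qPoch q q (N - a))) atTop
      (𝓝 (qPochInf q q / (qPoch q q a * qPochInf q q))) :=
    h1.div ((h1.comp (tendsto_sub_atTop_nat a)).const_mul _)
      (mul_ne_zero (qPoch_self_ne_zero hq a) h0)
  rw [mul_comm, ← div_div, div_self h0, one_div] at h2
  refine h2.congr' ?_
  filter_upwards [eventually_ge_atTop a] with N hN
  rw [qBinom_of_le hN]

theorem tendsto_central_qBinom {q : ℂ} (hq : ‖q‖ < 1) (s : ℕ) :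
    Tendsto (fun N => qBinom q (2 * N) (N + s)) atTop (𝓝 (qPochInf q q)⁻¹) := by
  have h0 := qPochInf_self_ne_zero hq
  have h1 := tendsto_qPoch q hq
  have h2 : Tendsto (fun N => qPoch q q (2 * N) / (qPoch q q (N + s) * qPoch q q (N - s))) atTop
      (𝓝 (qPochInf q q / (qPochInf q q * qPochInf q q))) :=
    (h1.comp (tendsto_id.const_mul_atTop' two_pos)).div
      ((h1.comp (tendsto_add_atTop_nat s)).mul (h1.comp (tendsto_sub_atTop_nat s)))
      (mul_ne_zero h0 h0)
  rw [← div_div, div_self h0, one_div] at h2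
  refine h2.congr' ?_
  filter_upwards [eventually_ge_atTop s] with N hN
  rw [qBinom_of_le (by omega), show 2 * N - (N + s) = N - s by omega]

/-- As `|j| ≤ s j`, the q-binomial is zero for `|j| > N`, so the finite sum is a full series; the
uniform bound on q-binomials then gives dominated convergence. -/
theorem tendsto_sum_central_qBinom {q : ℂ} (hq : ‖q‖ < 1) {c : ℤ → ℂ}
    (hc : Summable fun j => ‖c j‖) {s : ℤ → ℕ} (hs : ∀ j, j.natAbs ≤ s j) :
    Tendsto (fun N : ℕ => ∑ j ∈ Finset.Icc (-N : ℤ) N, c j * qBinom q (2 * N) (N + s j)) atTop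
      (𝓝 ((∑' j, c j) * (qPochInf q q)⁻¹)) := by
  obtain ⟨C, hC0, hC⟩ := exists_norm_qBinom_le hq
  have key := tendsto_tsum_of_dominated_convergence (𝓕 := atTop)
    (f := fun (N : ℕ) (j : ℤ) => c j * qBinom q (2 * N) (N + s j))
    (g := fun j => c j * (qPochInf q q)⁻¹) (hc.mul_right C)
    (fun j => (tendsto_central_qBinom hq (s j)).const_mul (c j))
    (Eventually.of_forall fun N j => by
      rw [norm_mul]
      gcongr
      exact hC _ _)
  rw [tsum_mul_right] at key
  refine key.congr fun N => tsum_eq_sum fun j hj => ?_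
  have := hs j
  rw [qBinom_of_lt, mul_zero]
  simp only [Finset.mem_Icc] at hj
  omega

theorem summable_pow_natAbs {x : ℝ} (h0 : 0 ≤ x) (h1 : x < 1) :
    Summable fun j : ℤ => x ^ j.natAbs := by
  refine Summable.of_nat_of_neg ?_ ?_ <;> simpa using summable_geometric_of_lt_one h0 h1

theorem triangular_neg_add (j : ℤ) : triangular (-j) + triangular j = j.natAbs ^ 2 := by
  have e1 := two_mul_triangular j
  have e2 := two_mul_triangular (-j)
  zify
  rw [sq_abs]
  linarith

theorem summable_norm_thetaTerm {x y : ℂ} (hx : ‖x‖ < 1) (hy : ‖y‖ < 1) :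
    Summable fun j => ‖thetaTerm x y j‖ := by
  have h0 : 0 ≤ max ‖x‖ ‖y‖ := (norm_nonneg x).trans (le_max_left _ _)
  have h1 : max ‖x‖ ‖y‖ < 1 := max_lt hx hy
  refine (summable_pow_natAbs h0 h1).of_nonneg_of_le (fun _ => norm_nonneg _) fun j => ?_
  calc ‖thetaTerm x y j‖ = ‖x‖ ^ triangular (-j) * ‖y‖ ^ triangular j := by
        simp [thetaTerm]
    _ ≤ max ‖x‖ ‖y‖ ^ triangular (-j) * max ‖x‖ ‖y‖ ^ triangular j := by
        gcongr
        · exact le_max_left _ _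
        · exact le_max_right _ _
    _ = max ‖x‖ ‖y‖ ^ (j.natAbs ^ 2) := by rw [← pow_add, triangular_neg_add]
    _ ≤ max ‖x‖ ‖y‖ ^ j.natAbs :=
        pow_le_pow_of_le_one h0 h1.le (Nat.le_self_pow two_ne_zero _)

/-- The Jacobi triple product identity. -/
theorem tsum_thetaTerm {x y q : ℂ} (hxy : x * y = q) (hx : ‖x‖ < 1) (hy : ‖y‖ < 1) :
    ∑' j, thetaTerm x y j = qPochInf x q * qPochInf y q * qPochInf q q := by
  have hq : ‖q‖ < 1 := by
    rw [← hxy, norm_mul]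
    exact mul_lt_one_of_nonneg_of_lt_one_left (norm_nonneg x) hx hy.le
  have h1 := tendsto_sum_central_qBinom hq (summable_norm_thetaTerm hx hy)
    (s := Int.natAbs) fun j => le_rfl
  have h2 := (tendsto_qPoch x hq).mul (tendsto_qPoch y hq)
  have h3 := tendsto_nhds_unique h2
    (h1.congr fun N => (qPoch_mul_qPoch_eq_sum_Icc hxy hq (le_refl N)).symm)
  rw [h3, inv_mul_cancel_right₀ (qPochInf_self_ne_zero hq)]

theorem tendsto_baseStep {q : ℂ} (hq : ‖q‖ < 1) (r : ℕ) :
    Tendsto (fun N => baseStep q N r) atTop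
      (𝓝 (qPochInf (-q) q * ((q ^ 2) ^ r ^ 2 / qPoch (q ^ 2) (q ^ 2) (2 * r)))) := by
  have h := (((tendsto_qPoch (-q) hq).comp (tendsto_sub_atTop_nat (2 * r))).mul
    (tendsto_qBinom (norm_sq_lt_one hq) (2 * r))).const_mul (q ^ (2 * r ^ 2))
  rw [show qPochInf (-q) q * ((q ^ 2) ^ r ^ 2 / qPoch (q ^ 2) (q ^ 2) (2 * r))
    = q ^ (2 * r ^ 2) * (qPochInf (-q) q * (qPoch (q ^ 2) (q ^ 2) (2 * r))⁻¹) by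
      rw [← pow_mul]; ring]
  exact h

/-! ### Identifying the multisum. -/

theorem rrIndex_tail {d : ℕ} (n : Fin (d + 2) → ℕ) (j : ℕ) :
    rrIndex (k := d + 2) (Fin.tail n) (j + 1) = rrIndex (k := d + 3) n (j + 2) := by
  by_cases h : j + 1 ≤ d + 1
  · rw [rrIndex, rrIndex, dif_pos ⟨by omega, by omega⟩, dif_pos ⟨by omega, by omega⟩]
    rfl
  · rw [rrIndex, rrIndex, dif_neg (by omega), dif_neg (by omega)]

theorem stepChain_eq_prod (d : ℕ) (q : ℂ) (n : Fin (d + 1) → ℕ) :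
    stepChain d q (n 0) (Fin.tail n)
      = ∏ j ∈ Finset.range (d + 1), baseStep (q ^ 2 ^ j) (rrIndex (k := d + 2) n (j + 1))
          (rrIndex (k := d + 2) n (j + 2)) := by
  induction d generalizing q with
  | zero => simp [stepChain, rrIndex]
  | succ d ih =>
    rw [Finset.prod_range_succ', stepChain, ih,
      mul_comm]
    congr 1
    · refine Finset.prod_congr rfl fun j _ => ?_
      rw [rrIndex_tail, show j + 2 = j + 1 + 1 by rfl, rrIndex_tail, ← pow_mul, pow_succ' 2 j]
    · simp [rrIndex, Fin.tail]

/-- The kernel in base `q^{2^j}` supplies exactly the power `q^{2^{j+1} n_{j+2}²}`, leaving only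
`q^{n₁²}` outside the chain. -/
theorem rrTerm_eq (d : ℕ) (q : ℂ) (n : Fin (d + 1) → ℕ) :
    rrTerm (d + 2) q n
      = q ^ n 0 ^ 2 / qPoch q q (2 * n 0) * stepChain d q (n 0) (Fin.tail n) := by
  have hlast : rrIndex (k := d + 2) n (d + 2) = 0 := dif_neg (by omega)
  have hfirst : rrIndex (k := d + 2) n 1 = n 0 := dif_pos ⟨le_rfl, by omega⟩
  have e1 : ∑ j ∈ Finset.Icc 1 (d + 2 - 1), 2 ^ (j - 1) * rrIndex (k := d + 2) n j ^ 2
      = ∑ j ∈ Finset.range (d + 1), 2 ^ j * (2 * rrIndex (k := d + 2) n (j + 2) ^ 2)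
        + n 0 ^ 2 := by
    rw [show Finset.Icc 1 (d + 2 - 1) = Finset.Ico 1 (d + 2) by ext; simp; omega,
      Finset.sum_Ico_eq_sum_range]
    have := Finset.sum_range_succ'
      (fun j => 2 ^ j * rrIndex (k := d + 2) n (j + 1) ^ 2) (d + 1)
    rw [Finset.sum_range_succ, hlast] at this
    simp only [zero_add, pow_zero, one_mul, hfirst, ne_eq, OfNat.ofNat_ne_zero,
      not_false_eq_true, zero_pow, mul_zero, add_zero] at this
    rw [show d + 2 - 1 = d + 1 by omega]
    simp only [Nat.add_sub_cancel, add_comm 1]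
    rw [this]
    congr 1
    refine Finset.sum_congr rfl fun j _ => ?_
    ring
  rw [rrTerm, e1, stepChain_eq_prod, hfirst, pow_add, ← Finset.prod_pow_eq_pow_sum]
  simp only [baseStep]
  rw [Finset.prod_mul_distrib (f := fun j => (q ^ 2 ^ j) ^ (2 * rrIndex (k := d + 2) n (j + 2) ^ 2)),
    show Finset.Icc 2 (d + 2) = Finset.Ico 2 (d + 3) by ext; simp; omega,
    Finset.prod_Ico_eq_prod_range, show d + 3 - 2 = d + 1 by omega,
    Finset.prod_congr rfl fun j _ => pow_mul q _ _]
  have e2 : ∀ j, 2 + j - 2 = j := fun j => by omega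
  have e3 : ∀ j, q ^ 2 ^ (j + 1) = (q ^ 2 ^ j) ^ 2 := fun j => by
    rw [← pow_mul, pow_succ]
  have e4 : ∀ j, 2 + j - 1 = j + 1 := fun j => by omega
  simp only [e2, e4]
  simp only [e3, add_comm 2]
  ring

theorem tendsto_stepChain (d : ℕ) {p : ℂ} (hp : ‖p‖ < 1) (n : Fin (d + 1) → ℕ) :
    Tendsto (fun N => stepChain (d + 1) p N n) atTop
      (𝓝 (qPochInf (-p) p * rrTerm (d + 2) (p ^ 2) n)) := by
  rw [rrTerm_eq, ← mul_assoc]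
  exact (tendsto_baseStep hp (n 0)).mul_const _

theorem qPochInf_neg_mul_qPochInf {q : ℂ} (hq : ‖q‖ < 1) :
    qPochInf (-q) q * qPochInf q q = qPochInf (q ^ 2) (q ^ 2) :=
  tendsto_nhds_unique ((tendsto_qPoch (-q) hq).mul (tendsto_qPoch q hq))
    ((tendsto_qPoch (q ^ 2) (norm_sq_lt_one hq)).congr fun n => (qPoch_neg_mul_qPoch q n).symm)

theorem hasSum_rrTerm_sq (d : ℕ) {p : ℂ} (hp : ‖p‖ < 1) :
    HasSum (fun n : Fin (d + 1) → ℕ => rrTerm (d + 2) (p ^ 2) n)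
      ((∑' j : ℤ, thetaTerm ((p ^ 2) ^ (2 ^ (d + 1) * (2 ^ (d + 2) - 1)))
        ((p ^ 2) ^ (2 ^ (d + 1) * 2 ^ (d + 2))) j) / qPochInf (p ^ 2) (p ^ 2)) := by
  have hp2 := norm_sq_lt_one hp
  have hne := qPochInf_self_ne_zero hp
  have hne' : qPochInf (-p) p ≠ 0 := fun h => by
    have := qPochInf_neg_mul_qPochInf hp
    rw [h, zero_mul] at this
    exact qPochInf_self_ne_zero hp2 this.symm
  obtain ⟨C, -, hC⟩ := exists_norm_stepChain_le (d + 1) hp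
  have hsum := (summable_prod_pow (d + 1) (norm_nonneg p) hp).mul_left C
  -- The bound uniform in `N` passes to the termwise limit.
  have hS : Summable fun n : Fin (d + 1) → ℕ => qPochInf (-p) p * rrTerm (d + 2) (p ^ 2) n :=
    Summable.of_norm_bounded hsum fun n =>
      le_of_tendsto (tendsto_stepChain d hp n).norm (Eventually.of_forall fun N => hC N n)
  have h1 := tendsto_tsum_of_dominated_convergence (𝓕 := atTop) hsum (tendsto_stepChain d hp)
    (Eventually.of_forall fun N => hC N)
  have hpow : ∀ m : ℕ, m ≠ 0 → ‖(p ^ 2) ^ m‖ < 1 := fun m hm => by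
    rw [norm_pow]
    exact pow_lt_one₀ (norm_nonneg _) hp2 hm
  have hsub : 2 ^ (d + 2) - 1 ≠ 0 := by
    have := Nat.one_lt_two_pow (n := d + 2) (by omega)
    omega
  have h2 := tendsto_sum_central_qBinom hp (summable_norm_thetaTerm
    (hpow (2 ^ (d + 1) * (2 ^ (d + 2) - 1)) (mul_ne_zero (by positivity) hsub))
    (hpow (2 ^ (d + 1) * 2 ^ (d + 2)) (by positivity)))
    (s := fun j => 2 ^ (d + 2) * j.natAbs) fun j => Nat.le_mul_of_pos_left _ (by positivity)
  have h3 := tendsto_nhds_unique h1 (h2.congr fun N => by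
    rw [(hasSum_stepChain (d + 1) hp (le_refl N)).tsum_eq, thetaSum]
    refine Finset.sum_congr rfl fun j _ => ?_
    rw [thetaTerm, ← pow_mul (p ^ 2), ← pow_mul (p ^ 2), ← pow_add, ← pow_mul,
      ← triangular_neg_add]
    -- With `u = 2^{d+2} - 1`, `j²` splits into two triangular numbers, giving the weights `u` and
    -- `u + 1` that become the exponents of `x` and `y`.
    congr 3
    obtain ⟨u, hu⟩ := Nat.exists_eq_succ_of_ne_zero (pow_ne_zero (d + 2) (two_ne_zero (α := ℕ)))
    have hu' : u + 1 = 2 * 2 ^ (d + 1) := by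
      rw [← pow_succ']
      exact hu.symm
    rw [show 2 ^ (d + 1 + 1) = 2 ^ (d + 2) by rfl, hu, Nat.succ_sub_one, Nat.succ_eq_add_one]
    linear_combination (triangular j + u * (triangular (-j) + triangular j)) * hu'.symm)
  have h4 := hS.hasSum.mul_left (qPochInf (-p) p)⁻¹
  simp only [inv_mul_cancel_left₀ hne'] at h4
  rw [h3] at h4
  rw [← qPochInf_neg_mul_qPochInf hp, div_eq_mul_inv, mul_inv, mul_left_comm]
  exact h4

theorem theorem7p1 (k : ℕ) (hk : 2 ≤ k) (q : ℂ) (hq : ‖q‖ < 1) :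
    HasSum (fun n : Fin (k - 1) → ℕ => rrTerm k q n)
      (qPochInf (q ^ ((4 ^ k - 2 ^ k) / 2)) (q ^ (4 ^ k - 2 ^ (k - 1)))
        * qPochInf (q ^ (4 ^ k / 2)) (q ^ (4 ^ k - 2 ^ (k - 1)))
        * qPochInf (q ^ (4 ^ k - 2 ^ (k - 1))) (q ^ (4 ^ k - 2 ^ (k - 1)))
        / qPochInf q q) := by
  obtain ⟨d, rfl⟩ := Nat.exists_eq_add_of_le' hk
  -- The limit of the outermost kernel lives in the square of its base, hence the square root.
  obtain ⟨p, rfl⟩ := IsAlgClosed.exists_pow_nat_eq q two_pos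
  have hp : ‖p‖ < 1 := by
    rw [norm_pow] at hq
    exact (pow_lt_one_iff_of_nonneg (norm_nonneg p) two_ne_zero).mp hq
  have hpow : ∀ m : ℕ, m ≠ 0 → ‖(p ^ 2) ^ m‖ < 1 := fun m hm => by
    rw [norm_pow]
    exact pow_lt_one₀ (norm_nonneg _) hq hm
  -- Setting `2^{k-1} = v + 1` clears truncated subtraction and shows that the triple product's base
  -- is the product of its two other arguments.
  obtain ⟨v, hv⟩ := Nat.exists_eq_succ_of_ne_zero (pow_ne_zero (d + 1) (two_ne_zero (α := ℕ)))
  have e2 : 2 ^ (d + 2) = 2 * (v + 1) := by rw [pow_succ, hv, mul_comm]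
  have e4 : 4 ^ (d + 2) = 2 * ((v + 1) * (2 * (v + 1))) := by
    rw [show 4 = 2 ^ 2 by rfl, ← pow_mul, mul_comm 2, pow_mul, e2]
    ring
  have ea : (4 ^ (d + 2) - 2 ^ (d + 2)) / 2 = (v + 1) * (2 * v + 1) := by
    rw [e4, e2, ← Nat.mul_sub, Nat.mul_div_cancel_left _ two_pos]
    refine Nat.sub_eq_of_eq_add ?_
    ring
  have eb : 4 ^ (d + 2) / 2 = (v + 1) * (2 * (v + 1)) := by
    rw [e4, Nat.mul_div_cancel_left _ two_pos]
  have ec : 4 ^ (d + 2) - 2 ^ (d + 2 - 1) = (v + 1) * (2 * v + 1) + (v + 1) * (2 * (v + 1)) := by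
    rw [show d + 2 - 1 = d + 1 by omega, hv, e4]
    refine Nat.sub_eq_of_eq_add ?_
    simp only [Nat.succ_eq_add_one]
    ring
  have key := hasSum_rrTerm_sq d hp
  rw [hv, e2, show 2 * (v + 1) - 1 = 2 * v + 1 by omega, Nat.succ_eq_add_one,
    tsum_thetaTerm (pow_add _ _ _).symm (hpow _ (by positivity)) (hpow _ (by positivity)),
    ← ea, ← eb] at key
  rw [ec, ← ea, ← eb]
  exact key
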